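/- Let $n\ge 0$ and let $w\in S_n$. Pipe dreams. Consider the triangular table with cells $(i,j)$, $i,j\ge 1$, $i+j\le n+1$. A filling $P$ places crosses in some set $\mathrm{cross}(P)$ of cells with $i+j\le n$ and elbows in all other cells. Pipe $i$ enters at the left of row $i$, and the pipes run right and up; at an elbow the pipe coming from the left turns up and the pipe coming from below turns right; at a cross both go straight, except that a cross of two pipes which have already crossed is ignored (treated as an elbow). $P$ is a pipe dream of $w$ if for each $i$ the pipe $i$ leaves at the top of column $w(i)$. Let $\mathrm{Pipes}(w)$ be the set of all pipe dreams of $w$ (reduced and nonreduced). Pipe dream complex. Let $Q=(s_{n-1},\ldots,s_1,\,s_{n-1},\ldots,s_2,\,\ldots,\,s_{n-1},s_{n-2},\,s_{n-1})$ be the triangular word, whose letters are identified with the cells $(i,j)$, $i+j\le n$, read row by row from the top, each row from right to left, so that cell $(i,j)$ carries the simple reflection $s_{i+j-1}$. The pipe dream complex $PD(w)$ is the simplicial complex of those sets $F$ of positions of $Q$ for which the word $Q\setminus F$ has a subword that is a reduced decomposition of $w$ (permutations are multiplied as functions, $(uv)(i)=u(v(i))$). The empty set counts as a face. For $P\in\mathrm{Pipes}(w)$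 let $F(P)$ be the face of $PD(w)$ consisting of all positions with $i+j\le n$ not in $\mathrm{cross}(P)$, and let $\mathrm{codim}_{PD(w)}F(P)=\dim PD(w)-\dim F(P)$. For a $(d-1)$-dimensional simplicial complex $\mathcal C$ with $f_{i-1}$ faces of cardinality $i$, the $h$-polynomial is $h(\mathcal C,x)=\sum_{i=0}^{d} f_{i-1}\,x^{i}(1-x)^{d-i}$. The double $\beta$-Grothendieck polynomial of $w$ is $$\mathfrak{G}_w^{\beta}(\mathbf x,\mathbf y)=\sum_{P\in \mathrm{Pipes}(w)}\beta^{\mathrm{codim}_{PD(w)}F(P)}\prod_{(i,j)\in\mathrm{cross}(P)}(x_i-y_j),$$ where $\mathbf x=(x_1,\dots,x_{n-1})$, $\mathbf y=(y_1,\dots,y_{n-1})$, and $\mathfrak{G}_w^{\beta}(q,t)$ denotes the result of setting all $x_i$ to $q$ and all $y_j$ to $t$. Theorem 2.5. For every permutation $w\in S_n$, the identity $$\mathfrak{G}_w^{\beta-1}(q,q-1)=h(PD(w),\beta)$$ holds in $\mathbb Z[\beta,q]$. In particular, $\mathfrak{G}_w^{\beta-1}(q,q-1)\in\mathbb{Z}_{\ge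 0}[\beta]$. -/

import Mathlib

noncomputable section

namespace PipeDream

/-! ## Finite simplicial complexes and their `h`-polynomials -/

/-- A finite abstract simplicial complex on the vertex set `V`, presented by its finite set of
faces. The empty face is counted as a face (of dimension `-1`), so that the complex `{∅}`, the
`(-1)`-dimensional sphere, is allowed. (Mathlib's `PreAbstractSimplicialComplex` leaves out the
empty face.) -/
structure FiniteSimplicialComplex (V : Type) where
  faces : Finset (Finset V)
  down_closed : ∀ F ∈ faces, ∀ G : Finset V, G ⊆ F → G ∈ faces

namespace FiniteSimplicialComplex

variable {V : Type}

/-- The number `d` such that the complex is `(d - 1)`-dimensional: the largest cardinality of a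
face. -/
def rank (Δ : FiniteSimplicialComplex V) : ℕ :=
  Δ.faces.sup Finset.card

/-- The codimension of a face `F`, which is `dim Δ - dim F = (d - 1) - (|F| - 1)`. -/
def codim (Δ : FiniteSimplicialComplex V) (F : Finset V) : ℕ :=
  Δ.rank - F.card

/-- The `h`-polynomial `∑ hᵢ Xⁱ` of a `(d - 1)`-dimensional complex, where the `h`-vector is
defined by `∑ hᵢ X ^ (d - i) = ∑ f_{i - 1} (X - 1) ^ (d - i)`; equivalently
`∑ hᵢ Xⁱ = ∑_F X ^ |F| (1 - X) ^ (d - |F|)`, the sum being over all faces, the empty one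
included. -/
def hPolynomial (Δ : FiniteSimplicialComplex V) : Polynomial ℤ :=
  ∑ F ∈ Δ.faces, Polynomial.X ^ F.card * (1 - Polynomial.X) ^ (Δ.rank - F.card)

end FiniteSimplicialComplex

/-! ## The triangular table and the triangular word -/

/-- The cells of the triangular table of size `n` that may hold a cross. Rows and columns are
counted from `0`, so in the usual numbering from `1` these are the `(i, j)` with `i + j ≤ n`. -/
abbrev Cell (n : ℕ) : Type :=
  {c : Fin (n - 1) × Fin (n - 1) // (c.1 : ℕ) + (c.2 : ℕ) + 1 < n}

namespace Cell

variable {n : ℕ}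

/-- The row of a cell (from the top, starting at `0`). -/
def row (c : Cell n) : Fin (n - 1) := c.1.1

/-- The column of a cell (from the left, starting at `0`). -/
def col (c : Cell n) : Fin (n - 1) := c.1.2

/-- The number `row + column`, constant on antidiagonals. -/
def lo (c : Cell n) : Fin n :=
  ⟨(c.1.1 : ℕ) + (c.1.2 : ℕ), lt_of_le_of_lt (Nat.le_succ _) c.2⟩

/-- The number `row + column + 1`. -/
def hi (c : Cell n) : Fin n :=
  ⟨(c.1.1 : ℕ) + (c.1.2 : ℕ) + 1, c.2⟩

/-- The simple reflection attached to a cell. With numbering from `1` the cell `(i, j)` carries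
`s_{i + j - 1}`. -/
def letter (c : Cell n) : Equiv.Perm (Fin n) := Equiv.swap c.lo c.hi

end Cell

/-- All cells in reading order: the rows from top to bottom, each row from right to left.
Along this list the letters form the triangular word
`s_{n-1}, …, s_1, s_{n-1}, …, s_2, …, s_{n-1}, s_{n-2}, s_{n-1}`. Since every cell occurs exactly
once, the cells serve as names of the positions of that word. -/
def readingOrder (n : ℕ) : List (Cell n) :=
  (List.finRange (n - 1)).flatMap fun (i : Fin (n - 1)) =>
    (List.finRange (n - 1)).reverse.filterMap fun (j : Fin (n - 1)) =>
      if h : (i : ℕ) + (j : ℕ) + 1 < n then some ⟨(i, j), h⟩ else none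

/-- The subword of the triangular word on a set `R` of positions. -/
def subword {n : ℕ} (R : Finset (Cell n)) : List (Equiv.Perm (Fin n)) :=
  ((readingOrder n).filter (· ∈ R)).map Cell.letter

/-! ## The pipe dream complex -/

/-- A simple reflection of the symmetric group: the transposition of two consecutive points. -/
def IsSimpleReflection {n : ℕ} (s : Equiv.Perm (Fin n)) : Prop :=
  ∃ a b : Fin n, (a : ℕ) + 1 = (b : ℕ) ∧ s = Equiv.swap a b

/-- `L` is a reduced decomposition of `w`: a word in simple reflections with ordered product `w`,
of the least possible length. -/
def IsReducedDecomposition {n : ℕ} (L : List (Equiv.Perm (Fin n))) (w : Equiv.Perm (Fin n)) :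
    Prop :=
  (∀ s ∈ L, IsSimpleReflection s) ∧ L.prod = w ∧
    ∀ L' : List (Equiv.Perm (Fin n)), (∀ s ∈ L', IsSimpleReflection s) → L'.prod = w →
      L.length ≤ L'.length

/-- The subword `R` represents `w`. -/
def Represents {n : ℕ} (R : Finset (Cell n)) (w : Equiv.Perm (Fin n)) : Prop :=
  IsReducedDecomposition (subword R) w

/-- The subword `R` contains `w`: some subsequence of it represents `w`. -/
def ContainsPerm {n : ℕ} (R : Finset (Cell n)) (w : Equiv.Perm (Fin n)) : Prop :=
  ∃ S : Finset (Cell n), S ⊆ R ∧ Represents S w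

open Classical in
/-- The pipe dream complex `PD(w)`: its faces are the subwords of the triangular word whose
complement contains `w`. -/
def pipeDreamComplex {n : ℕ} (w : Equiv.Perm (Fin n)) : FiniteSimplicialComplex (Cell n) where
  faces := Finset.univ.filter fun F => ContainsPerm (Finset.univ \ F) w
  down_closed := by
    intro F hF G hGF
    simp only [Finset.mem_filter, Finset.mem_univ, true_and] at hF ⊢
    obtain ⟨S, hS, hw⟩ := hF
    exact ⟨S, hS.trans (Finset.sdiff_subset_sdiff (Finset.Subset.refl _) hGF), hw⟩

/-! ## Pipe dreams

A filling of the triangular table with crosses and elbows is given by the set `P` of the cells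
with a cross; all the other cells, including those on the bounding antidiagonal `i + j = n + 1`
(numbering from `1`), hold elbows. Pipe `i` enters the table at the left edge of row `i`, and the
pipes run to the right and upwards until they leave at the top edges of the columns. In an elbow
the pipe from the left turns to the top and the pipe from the bottom turns to the right; in a
cross both go straight on, unless the two pipes have crossed before, in which case the cross is
ignored, that is, it is treated as an elbow. -/

/-- A stage of drawing the pipes. The part of the table drawn so far is bounded by a path of `n`
edges from the lower left to the upper right corner. At the start these are the left edges of the
rows, at the end the top edges of the columns; in general, edge number `k` is either the left edge
of a cell with `row + column = k` or the top edge of such a cell (numbering from `0`).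
`pipeAt k` is the pipe that passes through edge number `k`, and `crossed` is the set of the
unordered pairs of pipes that have already crossed. -/
structure DrawingState (n : ℕ) where
  pipeAt : Fin n → Fin n
  crossed : Finset (Sym2 (Fin n))

/-- Draw one more cell `c`, in row `i` and column `j`: its left edge has number `i + j = lo` and its
bottom edge (the top edge of the cell below) has number `i + j + 1 = hi`; afterwards number `lo` is
its top edge and number `hi` is its right edge. So an elbow keeps the pipes on their numbers, and a
cross interchanges them, provided that the two pipes have not crossed before. -/
def drawCell {n : ℕ} (P : Finset (Cell n)) (st : DrawingState n) (c : Cell n) : DrawingState n :=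
  if c ∈ P ∧ s(st.pipeAt c.lo, st.pipeAt c.hi) ∉ st.crossed then
    { pipeAt := fun k => st.pipeAt (Equiv.swap c.lo c.hi k)
      crossed := insert s(st.pipeAt c.lo, st.pipeAt c.hi) st.crossed }
  else st

/-- Draw all the pipes: the rows from bottom to top, each row from left to right. -/
def drawPipes {n : ℕ} (P : Finset (Cell n)) : DrawingState n :=
  (readingOrder n).reverse.foldl (drawCell P) { pipeAt := fun k => k, crossed := ∅ }

/-- The pipes of the filling `P` intertwine according to `w`: the pipe that enters in row `i`
leaves in column `w i`. -/
def IsPipeDreamOf {n : ℕ} (P : Finset (Cell n)) (w : Equiv.Perm (Fin n)) : Prop :=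
  ∀ i : Fin n, (drawPipes P).pipeAt (w i) = i

open Classical in
/-- `Pipes(w)`, the set of all pipe dreams of `w`, reduced and nonreduced; a pipe dream is given by
the set `cross(P)` of its crosses. -/
def pipes {n : ℕ} (w : Equiv.Perm (Fin n)) : Finset (Finset (Cell n)) :=
  Finset.univ.filter fun P => IsPipeDreamOf P w

/-- The face `F(P)` labeled by `P`: the positions of the elbows, that is, the complement of
`cross(P)`. -/
def faceOf {n : ℕ} (P : Finset (Cell n)) : Finset (Cell n) :=
  Finset.univ \ P

/-! ## Double `β`-Grothendieck polynomials -/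

/-- The double `β`-Grothendieck polynomial
`𝔊_w^β(x, y) = ∑_{P ∈ Pipes(w)} β ^ codim F(P) ∏_{(i, j) ∈ cross(P)} (x_i - y_j)`.
The coefficient ring is `ℤ[β]`; `Sum.inl i` stands for `x_i` and `Sum.inr j` for `y_j`. -/
def doubleGrothendieck {n : ℕ} (w : Equiv.Perm (Fin n)) :
    MvPolynomial (Fin (n - 1) ⊕ Fin (n - 1)) (Polynomial ℤ) :=
  ∑ P ∈ pipes w,
    MvPolynomial.C (Polynomial.X ^ (pipeDreamComplex w).codim (faceOf P)) *
      ∏ c ∈ P, (MvPolynomial.X (Sum.inl c.row) - MvPolynomial.X (Sum.inr c.col))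

/-- The specialization `𝔊_w^b(q, t)` in a commutative ring `R`: `β` is replaced by `b`, all `x_i`
by `q` and all `y_j` by `t`. -/
def specializedGrothendieck {n : ℕ} {R : Type} [CommRing R] (w : Equiv.Perm (Fin n))
    (b q t : R) : R :=
  MvPolynomial.eval₂ (Polynomial.eval₂RingHom (Int.castRingHom R) b)
    (Sum.elim (fun _ => q) (fun _ => t)) (doubleGrothendieck w)

end PipeDream

end

/-!
Since `q - (q - 1) = 1`, the specialization is `∑ (β - 1) ^ (|P| - ℓ(w))` over the sets `P` of
crosses whose pipes intertwine according to `w`. Two pipes have crossed exactly when they are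
inverted, so the permutation drawn by `P` is the Demazure product of the letters at the crosses, the
cells being read in the order of the triangular word (`drawPipes_pipeAt`). On the other side, after
passing to complements, the `h`-polynomial is `∑ β ^ (N - |P|) (1 - β) ^ (|P| - ℓ(w))` over the sets
`P` whose subword contains a reduced word of `w`; here `N` is the number of all positions, and the
rank of the complex is `N - ℓ(w)`.

Both sums make sense for any list `l` of cells in place of the triangular word, and for `l = c :: l'`
with `s` the letter of `c` they satisfy the same recursion, which is the one coming from the vertex
decomposition of subword complexes:
* if `s w > w`, the value at `(l, w)` is the value at `(l', w)`;
* if `s w < w`, it is `β` times the value at `(l', w)` plus the value at `(l', s w)`.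

Hence the sums agree. As the recursion involves no subtraction, the coefficients are nonnegative.
The recursion for the Demazure product is immediate; the one for containment rests on the
exchange property (`exists_sublist_prod_eq_swap_mul`). Descents of `w` are detected by comparing
values of `w⁻¹` at consecutive points.
-/

namespace PipeDream

open Polynomial

variable {n : ℕ}

/-! ### Length and the exchange property in the symmetric group -/

/-- The Coxeter length of `w`: the least length of a word in simple reflections with product `w`. -/
noncomputable def coxeterLength (w : Equiv.Perm (Fin n)) : ℕ :=
  sInf {k | ∃ L : List (Equiv.Perm (Fin n)),
    (∀ s ∈ L, IsSimpleReflection s) ∧ L.prod = w ∧ L.length = k}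

theorem exists_word (w : Equiv.Perm (Fin n)) :
    ∃ L : List (Equiv.Perm (Fin n)), (∀ s ∈ L, IsSimpleReflection s) ∧ L.prod = w := by
  cases n with
  | zero => exact ⟨[], by simp, Subsingleton.elim _ _⟩
  | succ n =>
    have hw : w ∈ Submonoid.closure
        (Set.range fun i : Fin n => Equiv.swap i.castSucc i.succ) := by
      rw [Equiv.Perm.mclosure_swap_castSucc_succ]
      trivial
    obtain ⟨L, hL, hprod⟩ := Submonoid.exists_list_of_mem_closure hw
    refine ⟨L, fun s hs => ?_, hprod⟩
    obtain ⟨i, rfl⟩ := hL s hs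
    exact ⟨i.castSucc, i.succ, by simp, rfl⟩

theorem coxeterLength_le {L : List (Equiv.Perm (Fin n))} {w : Equiv.Perm (Fin n)}
    (hL : ∀ s ∈ L, IsSimpleReflection s) (hprod : L.prod = w) :
    coxeterLength w ≤ L.length :=
  Nat.sInf_le ⟨L, hL, hprod, rfl⟩

theorem exists_word_length_eq (w : Equiv.Perm (Fin n)) :
    ∃ L : List (Equiv.Perm (Fin n)), (∀ s ∈ L, IsSimpleReflection s) ∧ L.prod = w ∧
      L.length = coxeterLength w := by
  obtain ⟨L, hL, hprod⟩ := exists_word w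
  exact Nat.sInf_mem (s := {k | ∃ L : List (Equiv.Perm (Fin n)),
    (∀ s ∈ L, IsSimpleReflection s) ∧ L.prod = w ∧ L.length = k}) ⟨_, L, hL, hprod, rfl⟩

theorem isReducedDecomposition_iff {L : List (Equiv.Perm (Fin n))} {w : Equiv.Perm (Fin n)} :
    IsReducedDecomposition L w ↔
      (∀ s ∈ L, IsSimpleReflection s) ∧ L.prod = w ∧ L.length = coxeterLength w := by
  constructor
  · rintro ⟨hL, hprod, hmin⟩
    obtain ⟨L', hL', hprod', hlen⟩ := exists_word_length_eq w
    exact ⟨hL, hprod, le_antisymm (hlen ▸ hmin L' hL' hprod') (coxeterLength_le hL hprod)⟩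
  · rintro ⟨hL, hprod, hlen⟩
    exact ⟨hL, hprod, fun L' hL' hprod' => hlen ▸ coxeterLength_le hL' hprod'⟩

/-- A simple reflection inverts only one pair. -/
theorem IsSimpleReflection.eq_swap_of_lt {t : Equiv.Perm (Fin n)} (ht : IsSimpleReflection t)
    {a b : Fin n} (hab : a < b) (h : t b < t a) : t = Equiv.swap a b := by
  obtain ⟨x, y, hxy, rfl⟩ := ht
  simp only [Equiv.swap_apply_def] at h
  have : a = x ∧ b = y := by
    simp only [Fin.ext_iff, Fin.lt_def] at *
    split_ifs at h <;> omega
  rw [this.1, this.2]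

/-- The exchange property: if the product `w` of a word has `a < b` inverted, that is,
`w⁻¹ b < w⁻¹ a`, then `swap a b * w` is obtained by deleting one letter. -/
theorem exists_sublist_prod_eq_swap_mul {L : List (Equiv.Perm (Fin n))}
    (hL : ∀ s ∈ L, IsSimpleReflection s) {a b : Fin n} (hab : a < b)
    (h : L.prod⁻¹ b < L.prod⁻¹ a) :
    ∃ L' : List (Equiv.Perm (Fin n)), L'.Sublist L ∧ L'.length + 1 = L.length ∧
      L'.prod = Equiv.swap a b * L.prod := by
  induction L generalizing a b with
  | nil => exact absurd h (by simpa using hab.le)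
  | cons t L ih =>
    have ht : IsSimpleReflection t := hL t (by simp)
    have htt : t⁻¹ = t := by
      obtain ⟨x, y, -, rfl⟩ := ht
      exact Equiv.swap_inv x y
    rcases lt_or_gt_of_ne (t.injective.ne hab.ne) with hlt | hgt
    · simp only [List.prod_cons, mul_inv_rev, Equiv.Perm.mul_apply, htt] at h
      obtain ⟨L', hsub, hlen, hprod⟩ := ih (fun s hs => hL s (by simp [hs])) hlt h
      refine ⟨t :: L', hsub.cons_cons t, by simp [hlen], ?_⟩
      have htt' : ∀ x, t (t x) = x := fun x => by
        have hx : t⁻¹ (t x) = x := by simp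
        rwa [htt] at hx
      rw [List.prod_cons, List.prod_cons, hprod, ← mul_assoc, ← mul_assoc,
        Equiv.mul_swap_eq_swap_mul, htt', htt']
    · -- The first letter is the transposition itself.
      have := ht.eq_swap_of_lt hab hgt
      exact ⟨L, List.sublist_cons_self t L, rfl, by simp [this]⟩

theorem coxeterLength_swap_mul_of_descent {w : Equiv.Perm (Fin n)} {a b : Fin n}
    (hab : (a : ℕ) + 1 = b) (h : w⁻¹ b < w⁻¹ a) :
    coxeterLength (Equiv.swap a b * w) + 1 = coxeterLength w := by
  have hlt : a < b := by rw [Fin.lt_def]; omega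
  apply le_antisymm
  · obtain ⟨L, hL, rfl, hlen⟩ := exists_word_length_eq w
    obtain ⟨L', hsub, hlen', hprod⟩ := exists_sublist_prod_eq_swap_mul hL hlt h
    have := coxeterLength_le (fun s hs => hL s (hsub.subset hs)) hprod
    omega
  · obtain ⟨L, hL, hprod, hlen⟩ := exists_word_length_eq (Equiv.swap a b * w)
    have := coxeterLength_le (L := Equiv.swap a b :: L) (w := w)
      (by simpa using ⟨⟨a, b, hab, rfl⟩, hL⟩) (by simp [hprod])
    simpa [hlen] using this

theorem Cell.lo_add_one (c : Cell n) : (c.lo : ℕ) + 1 = c.hi := rfl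

theorem Cell.lo_lt_hi (c : Cell n) : c.lo < c.hi := Nat.lt_succ_self _

theorem Cell.isSimpleReflection_letter (c : Cell n) : IsSimpleReflection c.letter :=
  ⟨c.lo, c.hi, rfl, rfl⟩

@[simp]
theorem Cell.letter_mul_letter_mul (c : Cell n) (w : Equiv.Perm (Fin n)) :
    c.letter * (c.letter * w) = w := by
  simp [Cell.letter]

/-- The letter of the cell `c` is a left ascent of `w`: multiplying `w` by it on the left makes `w`
longer. -/
def IsAscent (c : Cell n) (w : Equiv.Perm (Fin n)) : Prop := w⁻¹ c.lo < w⁻¹ c.hi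

theorem not_isAscent_iff {c : Cell n} {w : Equiv.Perm (Fin n)} :
    ¬ IsAscent c w ↔ w⁻¹ c.hi < w⁻¹ c.lo := by
  have := w⁻¹.injective.ne c.lo_lt_hi.ne
  rw [IsAscent, not_lt]
  exact ⟨fun h => lt_of_le_of_ne h this.symm, le_of_lt⟩

theorem isAscent_letter_mul_iff {c : Cell n} {w : Equiv.Perm (Fin n)} :
    IsAscent c (c.letter * w) ↔ ¬ IsAscent c w := by
  rw [not_isAscent_iff]
  simp [IsAscent, Cell.letter]

theorem coxeterLength_letter_mul_of_not_isAscent {c : Cell n} {w : Equiv.Perm (Fin n)}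
    (h : ¬ IsAscent c w) : coxeterLength (c.letter * w) + 1 = coxeterLength w :=
  coxeterLength_swap_mul_of_descent c.lo_add_one (not_isAscent_iff.1 h)

theorem coxeterLength_letter_mul_of_isAscent {c : Cell n} {w : Equiv.Perm (Fin n)}
    (h : IsAscent c w) : coxeterLength (c.letter * w) = coxeterLength w + 1 := by
  have := coxeterLength_letter_mul_of_not_isAscent (c := c) (w := c.letter * w)
    (by rwa [isAscent_letter_mul_iff, not_not])
  rw [Cell.letter_mul_letter_mul] at this
  exact this.symm

/-! ### Containment of a permutation in a word -/

/-- Some subsequence of the word carried by the list `K` of cells is a reduced decomposition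
of `w`. -/
def Contains (K : List (Cell n)) (w : Equiv.Perm (Fin n)) : Prop :=
  ∃ L : List (Equiv.Perm (Fin n)), L.Sublist (K.map Cell.letter) ∧ IsReducedDecomposition L w

theorem Contains.coxeterLength_le {K : List (Cell n)} {w : Equiv.Perm (Fin n)}
    (h : Contains K w) : coxeterLength w ≤ K.length := by
  obtain ⟨L, hsub, hL⟩ := h
  have := hsub.length_le
  rwa [(isReducedDecomposition_iff.1 hL).2.2, List.length_map] at this

theorem contains_nil_iff {w : Equiv.Perm (Fin n)} : Contains [] w ↔ w = 1 := by
  constructor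
  · rintro ⟨L, hsub, hL⟩
    obtain rfl := List.sublist_nil.1 hsub
    exact hL.2.1.symm
  · rintro rfl
    exact ⟨[], by simp, by simp, by simp, by simp⟩

theorem contains_cons_of_isAscent {c : Cell n} {K : List (Cell n)} {w : Equiv.Perm (Fin n)}
    (h : IsAscent c w) : Contains (c :: K) w ↔ Contains K w := by
  constructor
  · rintro ⟨L, hsub, hL⟩
    rw [List.map_cons, List.sublist_cons_iff] at hsub
    rcases hsub with hsub | ⟨L', rfl, hsub⟩
    · exact ⟨L, hsub, hL⟩
    · -- A reduced word of `w` cannot start with an ascent.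
      obtain ⟨hs, hprod, hlen⟩ := isReducedDecomposition_iff.1 hL
      have h1 := PipeDream.coxeterLength_le (L := L') (w := c.letter * w)
        (fun s hs' => hs s (by simp [hs'])) (by rw [← hprod]; simp)
      rw [coxeterLength_letter_mul_of_isAscent h, ← hlen, List.length_cons] at h1
      omega
  · rintro ⟨L, hsub, hL⟩
    exact ⟨L, hsub.trans (List.sublist_cons_self _ _), hL⟩

theorem contains_cons_of_not_isAscent {c : Cell n} {K : List (Cell n)} {w : Equiv.Perm (Fin n)}
    (h : ¬ IsAscent c w) : Contains (c :: K) w ↔ Contains K (c.letter * w) := by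
  have hlen_w := coxeterLength_letter_mul_of_not_isAscent h
  constructor
  · rintro ⟨L, hsub, hL⟩
    obtain ⟨hs, hprod, hlen⟩ := isReducedDecomposition_iff.1 hL
    rw [List.map_cons, List.sublist_cons_iff] at hsub
    rcases hsub with hsub | ⟨L', rfl, hsub⟩
    · subst hprod
      obtain ⟨L', hsub', hlen', hprod'⟩ :=
        exists_sublist_prod_eq_swap_mul hs c.lo_lt_hi (not_isAscent_iff.1 h)
      exact ⟨L', hsub'.trans hsub, isReducedDecomposition_iff.2
        ⟨fun s hs' => hs s (hsub'.subset hs'), hprod', by omega⟩⟩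
    · refine ⟨L', hsub, isReducedDecomposition_iff.2
        ⟨fun s hs' => hs s (by simp [hs']), by rw [← hprod]; simp, ?_⟩⟩
      rw [List.length_cons] at hlen
      omega
  · rintro ⟨L, hsub, hL⟩
    obtain ⟨hs, hprod, hlen⟩ := isReducedDecomposition_iff.1 hL
    refine ⟨c.letter :: L, hsub.cons_cons _, isReducedDecomposition_iff.2 ⟨?_, ?_, ?_⟩⟩
    · simpa using ⟨c.isSimpleReflection_letter, hs⟩
    · rw [List.prod_cons, hprod, Cell.letter_mul_letter_mul]
    · rw [List.length_cons, hlen, hlen_w]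

/-! ### Demazure products and pipe dreams -/

open Classical in
/-- The Demazure product of the letters of a list of cells, accumulated from the right: a letter
that would shorten the permutation obtained so far is skipped. -/
noncomputable def demazure : List (Cell n) → Equiv.Perm (Fin n)
  | [] => 1
  | c :: K => if IsAscent c (demazure K) then c.letter * demazure K else demazure K

theorem contains_demazure (K : List (Cell n)) : Contains K (demazure K) := by
  induction K with
  | nil => exact contains_nil_iff.2 rfl
  | cons c K ih =>
    rw [demazure]
    split_ifs with h
    · rw [contains_cons_of_not_isAscent (by rwa [isAscent_letter_mul_iff, not_not])]
      simpa using ih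
    · obtain ⟨L, hsub, hL⟩ := ih
      exact ⟨L, hsub.trans (List.sublist_cons_self _ _), hL⟩

theorem demazure_cons_ne_of_isAscent {c : Cell n} {w : Equiv.Perm (Fin n)} (h : IsAscent c w)
    (K : List (Cell n)) : demazure (c :: K) ≠ w := by
  rintro rfl
  rw [demazure] at h
  split_ifs at h with h'
  · exact isAscent_letter_mul_iff.1 h h'
  · exact h' h

theorem demazure_cons_eq_iff_of_not_isAscent {c : Cell n} {w : Equiv.Perm (Fin n)}
    (h : ¬ IsAscent c w) (K : List (Cell n)) :
    demazure (c :: K) = w ↔ demazure K = w ∨ demazure K = c.letter * w := by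
  rw [demazure]
  split_ifs with h'
  · constructor
    · rintro rfl
      simp
    · rintro (rfl | hK)
      · exact absurd h' h
      · simp [hK]
  · constructor
    · exact Or.inl
    · rintro (hK | hK)
      · exact hK
      · rw [hK, isAscent_letter_mul_iff, not_not] at h'
        exact absurd h' h

theorem swap_apply_lt_swap_apply_iff {p q x y : Fin n} (hpq : (p : ℕ) + 1 = q)
    (h : ¬ (x = q ∧ y = p)) :
    Equiv.swap p q y < Equiv.swap p q x ↔ (x = p ∧ y = q) ∨ y < x := by
  simp only [Equiv.swap_apply_def]
  simp only [Fin.ext_iff, Fin.lt_def] at h ⊢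
  split_ifs <;> omega

/-- After the cells of `l` have been drawn from the last to the first, the edge numbers of the pipes
are given by the Demazure product of the crosses, and the pairs of pipes that have crossed are the
inversions of that permutation. -/
theorem foldr_drawCell (P : Finset (Cell n)) (l : List (Cell n)) :
    let st := l.foldr (fun c st => drawCell P st c) { pipeAt := fun k => k, crossed := ∅ }
    let v := demazure (l.filter (· ∈ P))
    (∀ k, st.pipeAt k = v⁻¹ k) ∧ ∀ a b, a < b → (s(a, b) ∈ st.crossed ↔ v b < v a) := by
  induction l with
  | nil =>
    refine ⟨fun k => rfl, fun a b hab => ?_⟩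
    simpa [demazure] using hab.le
  | cons c l ih =>
    simp only [List.foldr_cons, List.filter_cons] at ih ⊢
    generalize l.foldr (fun c st => drawCell P st c) { pipeAt := fun k => k, crossed := ∅ } = st
      at ih ⊢
    obtain ⟨hpipe, hcross⟩ := ih
    by_cases hc : c ∈ P
    · simp only [hc, decide_true, if_true]
      rw [demazure]
      generalize demazure (l.filter (· ∈ P)) = v at hpipe hcross ⊢
      have hiff : s(st.pipeAt c.lo, st.pipeAt c.hi) ∉ st.crossed ↔ IsAscent c v := by
        rw [hpipe, hpipe]
        rcases lt_or_gt_of_ne (v⁻¹.injective.ne c.lo_lt_hi.ne) with h | h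
        · rw [hcross _ _ h]
          exact ⟨fun _ => h, fun _ => by simpa using c.lo_lt_hi.le⟩
        · rw [Sym2.eq_swap, hcross _ _ h]
          exact ⟨fun hn => absurd (by simpa using c.lo_lt_hi) hn, fun h' => absurd h' h.not_gt⟩
      by_cases hasc : IsAscent c v
      · rw [drawCell, if_pos ⟨hc, hiff.2 hasc⟩, if_pos hasc]
        refine ⟨fun k => by simp [hpipe, Cell.letter], fun a b hab => ?_⟩
        have hpair : s(a, b) = s(v⁻¹ c.lo, v⁻¹ c.hi) ↔ v a = c.lo ∧ v b = c.hi := by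
          rw [Sym2.eq_iff, Equiv.Perm.eq_inv_iff_eq, Equiv.Perm.eq_inv_iff_eq,
            Equiv.Perm.eq_inv_iff_eq, Equiv.Perm.eq_inv_iff_eq]
          refine ⟨?_, Or.inl⟩
          rintro (h | ⟨h1, h2⟩)
          · exact h
          · have hba : b < a := by simpa [IsAscent, ← h1, ← h2] using hasc
            exact absurd hba hab.not_gt
        rw [Finset.mem_insert, hpipe, hpipe, hpair, hcross a b hab]
        refine (swap_apply_lt_swap_apply_iff c.lo_add_one ?_).symm
        rintro ⟨h1, h2⟩
        have hba : b < a := by simpa [IsAscent, ← h1, ← h2] using hasc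
        exact hba.not_gt hab
      · rw [drawCell, if_neg (fun h => hasc (hiff.1 h.2)), if_neg hasc]
        exact ⟨hpipe, hcross⟩
    · simp only [hc, decide_false, drawCell, false_and, if_false]
      exact ⟨hpipe, hcross⟩

theorem drawPipes_pipeAt (P : Finset (Cell n)) (k : Fin n) :
    (drawPipes P).pipeAt k = (demazure ((readingOrder n).filter (· ∈ P)))⁻¹ k := by
  rw [drawPipes, List.foldl_reverse]
  exact (foldr_drawCell P (readingOrder n)).1 k

theorem isPipeDreamOf_iff {P : Finset (Cell n)} {w : Equiv.Perm (Fin n)} :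
    IsPipeDreamOf P w ↔ demazure ((readingOrder n).filter (· ∈ P)) = w := by
  simp only [IsPipeDreamOf, drawPipes_pipeAt, Equiv.Perm.inv_eq_iff_eq]
  exact ⟨fun h => Equiv.ext fun i => (h i).symm, fun h i => by rw [h]⟩

/-! ### The common recursion -/

open Classical in
/-- The sum `∑ (β - 1) ^ (|K| - ℓ(w))` over the subwords `K` of `l` with Demazure product `w`. -/
noncomputable def demazureSum (l : List (Cell n)) (w : Equiv.Perm (Fin n)) : ℤ[X] :=
  (l.sublists'.map fun K =>
    if demazure K = w then (X - 1) ^ (K.length - coxeterLength w) else 0).sum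

open Classical in
/-- The sum `∑ β ^ (|l| - |K|) (1 - β) ^ (|K| - ℓ(w))` over the subwords `K` of `l` that
contain `w`. -/
noncomputable def containsSum (l : List (Cell n)) (w : Equiv.Perm (Fin n)) : ℤ[X] :=
  (l.sublists'.map fun K =>
    if Contains K w then X ^ (l.length - K.length) * (1 - X) ^ (K.length - coxeterLength w)
    else 0).sum

theorem demazureSum_nil (w : Equiv.Perm (Fin n)) :
    demazureSum [] w = if w = 1 then 1 else 0 := by
  by_cases h : w = 1
  · simp [demazureSum, demazure, h]
  · simp [demazureSum, demazure, h, Ne.symm h]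

theorem containsSum_nil (w : Equiv.Perm (Fin n)) :
    containsSum [] w = if w = 1 then 1 else 0 := by
  by_cases h : w = 1 <;> simp [containsSum, contains_nil_iff, h]

theorem demazureSum_cons_of_isAscent {c : Cell n} {w : Equiv.Perm (Fin n)} (h : IsAscent c w)
    (l : List (Cell n)) : demazureSum (c :: l) w = demazureSum l w := by
  simp [demazureSum, List.sublists'_cons, Function.comp_def, demazure_cons_ne_of_isAscent h]

theorem demazureSum_cons_of_not_isAscent {c : Cell n} {w : Equiv.Perm (Fin n)}
    (h : ¬ IsAscent c w) (l : List (Cell n)) :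
    demazureSum (c :: l) w = X * demazureSum l w + demazureSum l (c.letter * w) := by
  simp only [demazureSum, List.sublists'_cons, List.map_append, List.sum_append, List.map_map,
    Function.comp_def, ← List.sum_map_mul_left, ← List.sum_map_add]
  refine congrArg List.sum (List.map_congr_left fun K _ => ?_)
  have hlen := coxeterLength_letter_mul_of_not_isAscent h
  have hne : c.letter * w ≠ w := fun h' => by simp [h'] at hlen
  simp only [demazure_cons_eq_iff_of_not_isAscent h, List.length_cons]
  by_cases hK : demazure K = w
  · have hle := (contains_demazure K).coxeterLength_le
    rw [hK] at hle
    rw [if_pos hK, if_pos (Or.inl hK), if_neg (by rw [hK]; exact hne.symm), Nat.succ_sub hle,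
      pow_succ]
    ring
  · rw [if_neg hK]
    simp only [hK, false_or]
    rw [← hlen, Nat.add_sub_add_right]
    simp

theorem containsSum_cons_of_isAscent {c : Cell n} {w : Equiv.Perm (Fin n)} (h : IsAscent c w)
    (l : List (Cell n)) : containsSum (c :: l) w = containsSum l w := by
  simp only [containsSum, List.sublists'_cons, List.map_append, List.sum_append, List.map_map,
    Function.comp_def, ← List.sum_map_add]
  refine congrArg List.sum (List.map_congr_left fun K hK => ?_)
  have hKl := (List.mem_sublists'.1 hK).length_le
  have hiff := contains_cons_of_isAscent (K := K) h
  rw [List.length_cons, List.length_cons]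
  by_cases hw : Contains K w
  · rw [if_pos hw, if_pos (hiff.2 hw), if_pos hw, Nat.succ_sub hKl, Nat.succ_sub hw.coxeterLength_le, Nat.add_sub_add_right, pow_succ,
      pow_succ]
    ring
  · rw [if_neg hw, if_neg (hw ∘ hiff.1), if_neg hw, add_zero]

theorem containsSum_cons_of_not_isAscent {c : Cell n} {w : Equiv.Perm (Fin n)}
    (h : ¬ IsAscent c w) (l : List (Cell n)) :
    containsSum (c :: l) w = X * containsSum l w + containsSum l (c.letter * w) := by
  simp only [containsSum, List.sublists'_cons, List.map_append, List.sum_append, List.map_map,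
    Function.comp_def, ← List.sum_map_mul_left]
  congr 1
  · refine congrArg List.sum (List.map_congr_left fun K hK => ?_)
    have hKl := (List.mem_sublists'.1 hK).length_le
    rw [List.length_cons, Nat.succ_sub hKl, pow_succ]
    split_ifs <;> ring
  · refine congrArg List.sum (List.map_congr_left fun K _ => ?_)
    rw [List.length_cons, List.length_cons, ← coxeterLength_letter_mul_of_not_isAscent h,
      Nat.add_sub_add_right, Nat.add_sub_add_right, contains_cons_of_not_isAscent h]

theorem demazureSum_eq_containsSum (l : List (Cell n)) (w : Equiv.Perm (Fin n)) :
    demazureSum l w = containsSum l w := by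
  induction l generalizing w with
  | nil => rw [demazureSum_nil, containsSum_nil]
  | cons c l ih =>
    by_cases h : IsAscent c w
    · rw [demazureSum_cons_of_isAscent h, containsSum_cons_of_isAscent h, ih]
    · rw [demazureSum_cons_of_not_isAscent h, containsSum_cons_of_not_isAscent h, ih, ih]

theorem exists_demazureSum_eq_map (l : List (Cell n)) (w : Equiv.Perm (Fin n)) :
    ∃ g : ℕ[X], demazureSum l w = g.map (Nat.castRingHom ℤ) := by
  induction l generalizing w with
  | nil => exact ⟨if w = 1 then 1 else 0, by rw [demazureSum_nil]; split_ifs <;> simp⟩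
  | cons c l ih =>
    obtain ⟨g, hg⟩ := ih w
    obtain ⟨g', hg'⟩ := ih (c.letter * w)
    by_cases h : IsAscent c w
    · exact ⟨g, by rw [demazureSum_cons_of_isAscent h, hg]⟩
    · exact ⟨X * g + g', by rw [demazureSum_cons_of_not_isAscent h, hg, hg']; simp⟩

/-! ### Sets of positions as subwords of the triangular word -/

theorem nodup_readingOrder (n : ℕ) : (readingOrder n).Nodup := by
  rw [readingOrder, List.nodup_flatMap]
  constructor
  · intro i _
    refine List.Nodup.filterMap ?_ (List.nodup_reverse.2 (List.nodup_finRange _))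
    intro j j' c hj hj'
    simp only [Option.mem_def, Option.dite_none_right_eq_some, Option.some.injEq] at hj hj'
    obtain ⟨_, rfl⟩ := hj
    obtain ⟨_, h⟩ := hj'
    simpa using (congrArg (fun c : Cell n => c.1.2) h).symm
  · refine (List.nodup_finRange _).imp fun {i i'} hne => ?_
    intro c hc hc'
    simp only [List.mem_filterMap, Option.dite_none_right_eq_some, Option.some.injEq] at hc hc'
    obtain ⟨_, _, _, rfl⟩ := hc
    obtain ⟨_, _, _, h⟩ := hc'
    exact hne (congrArg (fun c : Cell n => c.1.1) h).symm

theorem mem_readingOrder (c : Cell n) : c ∈ readingOrder n := by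
  obtain ⟨⟨i, j⟩, h⟩ := c
  simp only [readingOrder, List.mem_flatMap, List.mem_filterMap]
  exact ⟨i, List.mem_finRange i, j, by simp, dif_pos h⟩

theorem toFinset_readingOrder (n : ℕ) : (readingOrder n).toFinset = Finset.univ := by
  ext c
  simp [mem_readingOrder c]

theorem length_readingOrder (n : ℕ) : (readingOrder n).length = Fintype.card (Cell n) := by
  rw [← List.toFinset_card_of_nodup (nodup_readingOrder n), toFinset_readingOrder,
    Finset.card_univ]

theorem length_filter_readingOrder (P : Finset (Cell n)) :
    ((readingOrder n).filter (· ∈ P)).length = P.card := by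
  rw [← List.toFinset_card_of_nodup ((nodup_readingOrder n).filter _)]
  congr 1
  ext c
  simp [mem_readingOrder c]

theorem sum_powerset_filter_eq_sum_sublists {α M : Type*} [DecidableEq α] [AddCommMonoid M]
    {l : List α} (hl : l.Nodup) (f : List α → M) :
    ∑ P ∈ l.toFinset.powerset, f (l.filter (· ∈ P)) = (l.sublists'.map f).sum := by
  induction l generalizing f with
  | nil => simp
  | cons c l ih =>
    obtain ⟨hc, hl⟩ := List.nodup_cons.1 hl
    rw [List.toFinset_cons, Finset.sum_powerset_insert (by simpa using hc), List.sublists'_cons,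
      List.map_append, List.sum_append, List.map_map, ← ih hl f, ← ih hl (f ∘ List.cons c)]
    congr 1
    · refine Finset.sum_congr rfl fun P hP => ?_
      have hcP : c ∉ P := fun h => hc (List.mem_toFinset.1 (Finset.mem_powerset.1 hP h))
      simp [hcP]
    · refine Finset.sum_congr rfl fun P _ => ?_
      have : l.filter (· ∈ insert c P) = l.filter (· ∈ P) := by
        refine List.filter_congr fun x hx => ?_
        have : x ≠ c := fun h => hc (h ▸ hx)
        simp [this]
      rw [List.filter_cons_of_pos (by simp), this, Function.comp_apply]

theorem sum_filter_readingOrder {M : Type*} [AddCommMonoid M] (f : List (Cell n) → M) :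
    ∑ P : Finset (Cell n), f ((readingOrder n).filter (· ∈ P)) =
      ((readingOrder n).sublists'.map f).sum := by
  rw [← sum_powerset_filter_eq_sum_sublists (nodup_readingOrder n), toFinset_readingOrder,
    Finset.powerset_univ]

theorem filter_mem_eq_of_sublist {α : Type*} [DecidableEq α] {K l : List α} (hl : l.Nodup)
    (h : K.Sublist l) : l.filter (· ∈ K) = K := by
  induction h with
  | slnil => rfl
  | @cons K l c h ih =>
    obtain ⟨hc, hl⟩ := List.nodup_cons.1 hl
    have hcK : c ∉ K := fun h' => hc (h.subset h')
    simpa [hcK] using ih hl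
  | @cons_cons K l c h ih =>
    obtain ⟨hc, hl⟩ := List.nodup_cons.1 hl
    have : l.filter (· ∈ c :: K) = l.filter (· ∈ K) := by
      refine List.filter_congr fun x hx => ?_
      have : x ≠ c := fun h => hc (h ▸ hx)
      simp [this]
    rw [List.filter_cons_of_pos (by simp), this, ih hl]

theorem containsPerm_iff {R : Finset (Cell n)} {w : Equiv.Perm (Fin n)} :
    ContainsPerm R w ↔ Contains ((readingOrder n).filter (· ∈ R)) w := by
  constructor
  · rintro ⟨S, hSR, hS⟩
    exact ⟨subword S, (List.monotone_filter_right _ fun c hc => by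
      simpa using hSR (by simpa using hc)).map _, hS⟩
  · rintro ⟨L, hsub, hL⟩
    obtain ⟨K, hK, rfl⟩ := List.sublist_map_iff.1 hsub
    refine ⟨K.toFinset, fun c hc => ?_, ?_⟩
    · simpa [mem_readingOrder] using hK.subset (List.mem_toFinset.1 hc)
    · rw [Represents, subword]
      rwa [(List.filter_congr fun x _ => by simp).trans
        (filter_mem_eq_of_sublist (nodup_readingOrder n) (hK.trans List.filter_sublist))]

/-! ### The pipe dream complex and the specialized Grothendieck polynomial -/

theorem mem_faces_iff {F : Finset (Cell n)} {w : Equiv.Perm (Fin n)} :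
    F ∈ (pipeDreamComplex w).faces ↔ Contains ((readingOrder n).filter (· ∈ Fᶜ)) w := by
  rw [← containsPerm_iff, Finset.compl_eq_univ_sdiff]
  simp [pipeDreamComplex]

theorem card_le_of_mem_faces {F : Finset (Cell n)} {w : Equiv.Perm (Fin n)}
    (hF : F ∈ (pipeDreamComplex w).faces) :
    F.card ≤ Fintype.card (Cell n) - coxeterLength w := by
  have h := (mem_faces_iff.1 hF).coxeterLength_le
  rw [length_filter_readingOrder, Finset.card_compl] at h
  have := Finset.card_le_univ F
  omega

/-- The complement of a reduced subword for `w` is a facet, of cardinality `N - ℓ(w)`, where `N` is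
the number of positions. -/
theorem rank_pipeDreamComplex {F : Finset (Cell n)} {w : Equiv.Perm (Fin n)}
    (hF : F ∈ (pipeDreamComplex w).faces) :
    (pipeDreamComplex w).rank = Fintype.card (Cell n) - coxeterLength w := by
  apply le_antisymm
  · exact Finset.sup_le fun G hG => card_le_of_mem_faces hG
  · obtain ⟨S, -, hS⟩ := containsPerm_iff.2 (mem_faces_iff.1 hF)
    have hSmem : Sᶜ ∈ (pipeDreamComplex w).faces := by
      rw [mem_faces_iff, compl_compl, ← containsPerm_iff]
      exact ⟨S, subset_rfl, hS⟩
    have hcard : S.card = coxeterLength w := by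
      rw [← (isReducedDecomposition_iff.1 hS).2.2, subword, List.length_map,
        length_filter_readingOrder]
    rw [← hcard, ← Finset.card_compl]
    exact Finset.le_sup (f := Finset.card) hSmem

theorem hPolynomial_pipeDreamComplex (w : Equiv.Perm (Fin n)) :
    (pipeDreamComplex w).hPolynomial = containsSum (readingOrder n) w := by
  classical
  rw [containsSum, ← sum_filter_readingOrder, FiniteSimplicialComplex.hPolynomial,
    ← Finset.sum_filter]
  refine Finset.sum_nbij' compl compl ?_ ?_ (by simp) (by simp) ?_
  · intro F hF
    simpa using mem_faces_iff.1 hF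
  · intro P hP
    rw [mem_faces_iff, compl_compl]
    simpa using hP
  · intro F hF
    have h1 := (mem_faces_iff.1 hF).coxeterLength_le
    rw [rank_pipeDreamComplex hF]
    rw [length_filter_readingOrder] at h1 ⊢
    rw [length_readingOrder, Finset.card_compl] at *
    have h2 := Finset.card_le_univ F
    congr 2 <;> omega

theorem codim_faceOf {P : Finset (Cell n)} {w : Equiv.Perm (Fin n)} (hP : P ∈ pipes w) :
    (pipeDreamComplex w).codim (faceOf P) = P.card - coxeterLength w := by
  have hP' : demazure ((readingOrder n).filter (· ∈ P)) = w :=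
    isPipeDreamOf_iff.1 (by simpa [pipes] using hP)
  have hcont := contains_demazure ((readingOrder n).filter (· ∈ P))
  rw [hP'] at hcont
  have hface : Pᶜ ∈ (pipeDreamComplex w).faces := by rwa [mem_faces_iff, compl_compl]
  have h1 := hcont.coxeterLength_le
  rw [length_filter_readingOrder] at h1
  have h2 := Finset.card_le_univ P
  rw [faceOf, ← Finset.compl_eq_univ_sdiff, FiniteSimplicialComplex.codim,
    rank_pipeDreamComplex hface, Finset.card_compl]
  omega

theorem specializedGrothendieck_eq (w : Equiv.Perm (Fin n)) :
    specializedGrothendieck (R := ℤ[X][X]) w (C X - 1) X (X - 1) =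
      C (demazureSum (readingOrder n) w) := by
  classical
  rw [demazureSum, ← sum_filter_readingOrder, specializedGrothendieck, doubleGrothendieck,
    MvPolynomial.eval₂_sum, ← Finset.sum_filter, map_sum]
  refine Finset.sum_congr ?_ fun P hP => ?_
  · ext P
    simp [pipes, isPipeDreamOf_iff]
  · have hP' : P ∈ pipes w := by simpa [pipes, isPipeDreamOf_iff] using hP
    rw [codim_faceOf hP', length_filter_readingOrder,
      MvPolynomial.eval₂_mul, MvPolynomial.eval₂_C, MvPolynomial.eval₂_prod,
      Finset.prod_eq_one, mul_one]
    · simp only [map_pow, map_sub, map_one, coe_eval₂RingHom, eval₂_X]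
    · intro c _
      rw [MvPolynomial.eval₂_sub, MvPolynomial.eval₂_X, MvPolynomial.eval₂_X, Sum.elim_inl,
        Sum.elim_inr, sub_sub_cancel]

end PipeDream

/-- The identity holds in the polynomial ring `ℤ[β][q]`, where `β` is `C X`, `q` is the outer
variable `X`, and a polynomial in `β` alone is embedded by `C`. -/
theorem theorem2p5 (n : ℕ) (w : Equiv.Perm (Fin n)) :
    PipeDream.specializedGrothendieck (R := Polynomial (Polynomial ℤ)) w
        (Polynomial.C Polynomial.X - 1) Polynomial.X (Polynomial.X - 1) =
      Polynomial.C (PipeDream.pipeDreamComplex w).hPolynomial ∧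
    ∃ g : Polynomial ℕ,
      PipeDream.specializedGrothendieck (R := Polynomial (Polynomial ℤ)) w
          (Polynomial.C Polynomial.X - 1) Polynomial.X (Polynomial.X - 1) =
        Polynomial.C (g.map (Nat.castRingHom ℤ)) := by
  rw [PipeDream.specializedGrothendieck_eq, PipeDream.hPolynomial_pipeDreamComplex,
    PipeDream.demazureSum_eq_containsSum]
  refine ⟨rfl, ?_⟩
  obtain ⟨g, hg⟩ := PipeDream.exists_demazureSum_eq_map (PipeDream.readingOrder n) w
  exact ⟨g, by rw [← PipeDream.demazureSum_eq_containsSum, hg]⟩
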